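/- Consider a discounted Markov decision process with measurable state space $\mathcal S$ and action space $\mathcal A$, transition kernel $P(\cdot\mid s,a)$, initial state distribution $\rho$, discount factor $\gamma\in(0,1)$ and measurable reward $R:\mathcal S\times\mathcal A\to[-R_{\max},R_{\max}]$, $R_{\max}>0$. Let $\{\pi_\theta:\theta\in\mathbb R^d\}$ be a family of stochastic policies, where $\pi_\theta(\cdot\mid s)$ is a probability density with respect to a fixed $\sigma$-finite measure on $\mathcal A$ (for instance counting or Lebesgue measure), jointly measurable in $(s,a)$ and differentiable in $\theta$. Let $p(\cdot\mid\pi_\theta)$ be the law of the trajectory $\tau=(s_t,a_t)_{t\ge 0}$ with $s_0\sim\rho$, $a_t\sim\pi_\theta(\cdot\mid s_t)$, $s_{t+1}\sim P(\cdot\mid s_t,a_t)$, and write $\mathbb E$ for the expectation under $\tau\sim p(\cdot\mid\pi_\theta)$. For $\mathsf H\in\{0,1,2,\dots\}$ put $$J(\theta)=\mathbb E\Big[\sum_{t=0}^{\infty}\gamma^tR(s_t,a_t)\Big],\qquad J_{\mathsf H}(\theta)=\mathbb E\Big[\sum_{t=0}^{\mathsf H-1}\gamma^tR(s_t,a_t)\Big].$$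 Assume that there are constants $G_1,G_2>0$ such that for all $\theta,s,a$: $\pi_\theta(a\mid s)>0$, $\theta\mapsto\log\pi_\theta(a\mid s)$ is twice differentiable, $\|\nabla_\theta\log\pi_\theta(a\mid s)\|\le G_1$ and $\|\nabla_\theta^2\log\pi_\theta(a\mid s)\|\le G_2$ (Euclidean norm for vectors, operator norm for matrices). Then $J$ and $J_{\mathsf H}$ are twice differentiable on $\mathbb R^d$; the gradient and Hessian of $J_{\mathsf H}$ are given by $$\nabla J_{\mathsf H}(\theta)=\mathbb E\Big[\sum_{h=0}^{\mathsf H-1}\Big(\sum_{t=h}^{\mathsf H-1}\gamma^tR(s_t,a_t)\Big)\nabla_\theta\log\pi_\theta(a_h\mid s_h)\Big],$$ $$\nabla^2J_{\mathsf H}(\theta)=\mathbb E\Big[\nabla_\theta\Phi(\theta;\tau)\Big(\sum_{h=0}^{\mathsf H-1}\nabla_\theta\log\pi_\theta(a_h\mid s_h)\Big)^{T}+\nabla_\theta^2\Phi(\theta;\tau)\Big],\qquad \Phi(\theta;\tau)=\sum_{h=0}^{\mathsf H-1}\sum_{t=h}^{\mathsf H-1}\gamma^tR(s_t,a_t)\log\pi_\theta(a_h\mid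 s_h);$$ and for every $\theta\in\mathbb R^d$ $$\|\nabla J(\theta)-\nabla J_{\mathsf H}(\theta)\|\le D_g\gamma^{\mathsf H},\qquad \|\nabla^2J(\theta)-\nabla^2J_{\mathsf H}(\theta)\|\le D_H\gamma^{\mathsf H},$$ where $$D_g=\frac{G_1R_{\max}}{1-\gamma}\sqrt{\frac1{1-\gamma}+\mathsf H},\qquad D_H=\frac{R_{\max}(G_2+G_1^2)}{1-\gamma}\Big(\mathsf H+\frac1{1-\gamma}\Big).$$ -/

import Mathlib

open MeasureTheory ProbabilityTheory Finset

/-- A discounted Markov decision process with state space `S` and action space `A`: transition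
kernel `P`, bounded reward `R`, initial state distribution `ρ` and discount factor `γ`. -/
structure MDP (S A : Type*) [MeasurableSpace S] [MeasurableSpace A] where
  P : Kernel (S × A) S
  isMarkovKernel_P : IsMarkovKernel P
  Rmax : ℝ
  Rmax_pos : 0 < Rmax
  R : S → A → ℝ
  measurable_R : Measurable (Function.uncurry R)
  abs_R_le : ∀ s a, |R s a| ≤ Rmax
  ρ : Measure S
  isProbabilityMeasure_ρ : IsProbabilityMeasure ρ
  γ : ℝ
  γ_pos : 0 < γ
  γ_lt_one : γ < 1

attribute [instance] MDP.isMarkovKernel_P MDP.isProbabilityMeasure_ρ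

/-- A family of stochastic policies parametrized by `θ ∈ ℝ^d` and differentiable in `θ`:
`π.dens θ s a` is the density `π_θ(a|s)` of the action with respect to the reference measure `ν`
(counting measure for a discrete action space, Lebesgue measure for a continuous one). -/
structure PolicyFamily (S : Type*) {A : Type*} [MeasurableSpace S] [MeasurableSpace A]
    (ν : Measure A) (d : ℕ) where
  dens : EuclideanSpace ℝ (Fin d) → S → A → ℝ
  dens_nonneg : ∀ θ s a, 0 ≤ dens θ s a
  measurable_dens : ∀ θ, Measurable (Function.uncurry (dens θ))
  lintegral_dens : ∀ θ s, ∫⁻ a, ENNReal.ofReal (dens θ s a) ∂ν = 1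
  differentiable_dens : ∀ s a, Differentiable ℝ (fun θ => dens θ s a)

/-- The Hessian of `f` as an operator on `ℝ^d`: the derivative of its gradient. The norm on
`ℝ^d →L[ℝ] ℝ^d` is the operator norm. -/
noncomputable def hessian {d : ℕ} (f : EuclideanSpace ℝ (Fin d) → ℝ)
    (θ : EuclideanSpace ℝ (Fin d)) :
    EuclideanSpace ℝ (Fin d) →L[ℝ] EuclideanSpace ℝ (Fin d) :=
  fderiv ℝ (gradient f) θ

namespace PolicyFamily

variable {S A : Type*} [MeasurableSpace S] [MeasurableSpace A] {ν : Measure A} {d : ℕ}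

/-- `log π_θ(a|s)` as a function of `θ`. -/
noncomputable def logDens (π : PolicyFamily S ν d) (s : S) (a : A)
    (θ : EuclideanSpace ℝ (Fin d)) : ℝ :=
  Real.log (π.dens θ s a)

/-- Lipschitz and smooth policies with constants `G₁, G₂ > 0`: the function `log π_θ(a|s)` is
defined (`π_θ(a|s) > 0`), is twice differentiable in `θ`, its gradient is bounded by `G₁` and its
Hessian by `G₂`. -/
structure LS (π : PolicyFamily S ν d) (G₁ G₂ : ℝ) : Prop where
  G₁_pos : 0 < G₁
  G₂_pos : 0 < G₂
  dens_pos : ∀ θ s a, 0 < π.dens θ s a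
  differentiable_gradient : ∀ s a, Differentiable ℝ (gradient (π.logDens s a))
  norm_gradient_le : ∀ θ s a, ‖gradient (π.logDens s a) θ‖ ≤ G₁
  norm_hessian_le : ∀ θ s a, ‖hessian (π.logDens s a) θ‖ ≤ G₂

variable [SigmaFinite ν]

/-- The law of the action given the state, `π_θ(da|s) = π_θ(a|s) ν(da)`. -/
noncomputable def kernel (π : PolicyFamily S ν d) (θ : EuclideanSpace ℝ (Fin d)) : Kernel S A :=
  (Kernel.const S ν).withDensity (fun s a => ENNReal.ofReal (π.dens θ s a))

instance (π : PolicyFamily S ν d) (θ : EuclideanSpace ℝ (Fin d)) :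
    IsMarkovKernel (π.kernel θ) := by
  refine ⟨fun s => ⟨?_⟩⟩
  have hm : Measurable (Function.uncurry fun s a => ENNReal.ofReal (π.dens θ s a)) :=
    ENNReal.measurable_ofReal.comp (π.measurable_dens θ)
  rw [kernel, Kernel.withDensity_apply' _ hm, Kernel.const_apply, setLIntegral_univ]
  exact π.lintegral_dens θ s

end PolicyFamily

namespace MDP

variable {S A : Type*} [MeasurableSpace S] [MeasurableSpace A] {ν : Measure A} [SigmaFinite ν]
  {d : ℕ}

/-- One step of the state-action process: from `(s, a)` draw `s' ~ P(·|s, a)` and then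
`a' ~ π_θ(·|s')`. -/
noncomputable def stepKernel (M : MDP S A) (π : PolicyFamily S ν d)
    (θ : EuclideanSpace ℝ (Fin d)) : Kernel (S × A) (S × A) :=
  M.P ⊗ₖ Kernel.prodMkLeft (S × A) (π.kernel θ)

instance (M : MDP S A) (π : PolicyFamily S ν d) (θ : EuclideanSpace ℝ (Fin d)) :
    IsMarkovKernel (M.stepKernel π θ) := by
  unfold stepKernel; infer_instance

/-- The step kernel applied to the last entry of the history up to time `n`. -/
noncomputable def historyKernel (M : MDP S A) (π : PolicyFamily S ν d)
    (θ : EuclideanSpace ℝ (Fin d)) (n : ℕ) : Kernel ((i : Iic n) → S × A) (S × A) :=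
  (M.stepKernel π θ).comap (fun h => h ⟨n, mem_Iic.2 le_rfl⟩) (measurable_pi_apply _)

instance (M : MDP S A) (π : PolicyFamily S ν d) (θ : EuclideanSpace ℝ (Fin d)) (n : ℕ) :
    IsMarkovKernel (M.historyKernel π θ n) := by
  unfold historyKernel; infer_instance

/-- The law `p(·|π_θ)` of the trajectory `τ = (s_t, a_t)_{t ≥ 0}`: `s_0 ~ ρ`, `a_t ~ π_θ(·|s_t)`,
`s_{t+1} ~ P(·|s_t, a_t)`. -/
noncomputable def trajLaw (M : MDP S A) (π : PolicyFamily S ν d)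
    (θ : EuclideanSpace ℝ (Fin d)) : Measure (ℕ → S × A) :=
  Kernel.trajMeasure (X := fun _ => S × A) (M.ρ ⊗ₘ π.kernel θ) (M.historyKernel π θ)

/-- The expected return `J(θ)`. -/
noncomputable def J (M : MDP S A) (π : PolicyFamily S ν d) (θ : EuclideanSpace ℝ (Fin d)) : ℝ :=
  ∫ τ, ∑' t : ℕ, M.γ ^ t * M.R (τ t).1 (τ t).2 ∂(M.trajLaw π θ)

/-- The expected return `J_H(θ)` truncated at horizon `H`. -/
noncomputable def truncJ (M : MDP S A) (π : PolicyFamily S ν d) (H : ℕ)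
    (θ : EuclideanSpace ℝ (Fin d)) : ℝ :=
  ∫ τ, ∑ t ∈ range H, M.γ ^ t * M.R (τ t).1 (τ t).2 ∂(M.trajLaw π θ)

/-- The truncated reward-to-go `Ψ_h(τ) = ∑_{t=h}^{H-1} γ^t R(s_t, a_t)`. -/
noncomputable def rewardToGo (M : MDP S A) (H h : ℕ) (τ : ℕ → S × A) : ℝ :=
  ∑ t ∈ Ico h H, M.γ ^ t * M.R (τ t).1 (τ t).2

/-- `E[∑_{h=0}^{H-1} Ψ_h(τ) ∇ log π_θ(a_h|s_h)]`. -/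
noncomputable def truncPolicyGradient (M : MDP S A) (π : PolicyFamily S ν d) (H : ℕ)
    (θ : EuclideanSpace ℝ (Fin d)) : EuclideanSpace ℝ (Fin d) :=
  ∫ τ, ∑ h ∈ range H, M.rewardToGo H h τ • gradient (π.logDens (τ h).1 (τ h).2) θ
    ∂(M.trajLaw π θ)

/-- `Φ(θ; τ) = ∑_{h=0}^{H-1} ∑_{t=h}^{H-1} γ^t R(s_t, a_t) log π_θ(a_h|s_h)`. -/
noncomputable def truncPhi (M : MDP S A) (π : PolicyFamily S ν d) (H : ℕ) (τ : ℕ → S × A)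
    (θ : EuclideanSpace ℝ (Fin d)) : ℝ :=
  ∑ h ∈ range H, ∑ t ∈ Ico h H,
    M.γ ^ t * M.R (τ t).1 (τ t).2 * π.logDens (τ h).1 (τ h).2 θ

/-- The score `∇ log p(τ|π_θ)` of the trajectory truncated at horizon `H`; only the policy factors
of `p(τ|π_θ)` depend on `θ`. -/
noncomputable def truncScore (π : PolicyFamily S ν d) (H : ℕ) (τ : ℕ → S × A)
    (θ : EuclideanSpace ℝ (Fin d)) : EuclideanSpace ℝ (Fin d) :=
  ∑ h ∈ range H, gradient (π.logDens (τ h).1 (τ h).2) θ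

/-- `E[∇Φ(θ; τ) ∇ log p(τ|π_θ)ᵀ + ∇²Φ(θ; τ)]`; here `x yᵀ` is the operator `v ↦ ⟨y, v⟩ x`. -/
noncomputable def truncPolicyHessian (M : MDP S A) (π : PolicyFamily S ν d) (H : ℕ)
    (θ : EuclideanSpace ℝ (Fin d)) :
    EuclideanSpace ℝ (Fin d) →L[ℝ] EuclideanSpace ℝ (Fin d) :=
  ∫ τ, InnerProductSpace.rankOne ℝ (gradient (M.truncPhi π H τ) θ) (truncScore π H τ θ) +
    hessian (M.truncPhi π H τ) θ ∂(M.trajLaw π θ)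

end MDP

/-! The laws of the first `n` state-action pairs under `θ₁` and under `θ₀` differ by the likelihood
ratio `exp (ℓ θ₁ - ℓ θ₀)`, where `ℓ` is the sum of the first `n` log-densities. Differentiating
under the integral sign gives the score identity `∂ E[Z] = E[∂Z] + E[∂ℓ ⊗ Z]` for every bounded `Z`
that depends on those pairs only. As the reward at time `t` depends on the first `t + 1` pairs, only
the score `S` of `t + 1` pairs occurs in the derivatives of `E[R(s_t, a_t)]`; exchanging the sums
over rewards and scores gives the reward-to-go formulas.

For `Z` independent of `θ` the score identity also says that the increments of the score are
orthogonal, so `E‖S‖² ≤ (t + 1) G₁²`. Hence the gradient and the Hessian of `E[R(s_t, a_t)]` are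
bounded by `Rmax G₁ √(t + 1)` and `Rmax (G₂ + G₁²) (t + 1)`. The truncation errors are the tails of
the corresponding series, and the concavity of `√` bounds the tail with the square roots.
-/

section StrongMeasurability

variable {X E F : Type*} {mX : MeasurableSpace X} [NormedAddCommGroup F] [NormedSpace ℝ F]

lemma stronglyMeasurable_clm_of_apply [NormedAddCommGroup E] [NormedSpace ℝ E]
    [FiniteDimensional ℝ E] {L : X → E →L[ℝ] F} (hL : ∀ v, StronglyMeasurable fun x => L x v) :
    StronglyMeasurable L := by
  let b := Module.finBasis ℝ E
  let coord (i) : E →L[ℝ] ℝ := (b.coord i).toContinuousLinearMap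
  have hsum : L = fun x => ∑ i, (coord i).smulRight (L x (b i)) := by
    ext x v
    conv_lhs => rw [← b.sum_repr v, map_sum]
    simp [coord]
  rw [hsum]
  exact stronglyMeasurable_fun_sum _ fun i _ =>
    (ContinuousLinearMap.smulRightL ℝ E F (coord i)).continuous.comp_stronglyMeasurable (hL (b i))

lemma stronglyMeasurable_fderiv_param [NormedAddCommGroup E] [NormedSpace ℝ E]
    [FiniteDimensional ℝ E] {f : E → X → F} {θ : E} (hf : ∀ θ, StronglyMeasurable (f θ))
    (hd : ∀ x, DifferentiableAt ℝ (f · x) θ) :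
    StronglyMeasurable fun x => fderiv ℝ (f · x) θ := by
  refine stronglyMeasurable_clm_of_apply fun v => ?_
  have hlim : Filter.Tendsto (fun (c : ℝ) x => c • (f (θ + c⁻¹ • v) x - f θ x)) Filter.atTop
      (nhds fun x => fderiv ℝ (f · x) θ v) :=
    tendsto_pi_nhds.2 fun x => (hd x).hasFDerivAt.lim_real v
  exact stronglyMeasurable_of_tendsto _ (fun c => ((hf _).sub (hf θ)).const_smul c) hlim

lemma stronglyMeasurable_gradient_param [NormedAddCommGroup E] [InnerProductSpace ℝ E]
    [FiniteDimensional ℝ E] {f : E → X → ℝ} {θ : E} (hf : ∀ θ, StronglyMeasurable (f θ))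
    (hd : ∀ x, DifferentiableAt ℝ (f · x) θ) :
    StronglyMeasurable fun x => gradient (f · x) θ :=
  (InnerProductSpace.toDual ℝ E).symm.continuous.comp_stronglyMeasurable
    (stronglyMeasurable_fderiv_param hf hd)

lemma stronglyMeasurable_rankOne [NormedAddCommGroup E] [InnerProductSpace ℝ E] {f g : X → E}
    (hf : StronglyMeasurable f) (hg : StronglyMeasurable g) :
    StronglyMeasurable fun x => InnerProductSpace.rankOne ℝ (f x) (g x) := by
  simp_rw [InnerProductSpace.rankOne_def]
  exact isBoundedBilinearMap_smulRight.continuous.comp_stronglyMeasurable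
    (((innerSL ℝ).continuous.comp_stronglyMeasurable hg).prodMk hf)

end StrongMeasurability

lemma norm_smul_le_of_le {V : Type*} [SeminormedAddCommGroup V] [NormedSpace ℝ V] {r b c : ℝ}
    {v : V} (hr : ‖r‖ ≤ b) (hv : ‖v‖ ≤ c) : ‖r • v‖ ≤ b * c := by
  rw [norm_smul]
  exact mul_le_mul hr hv (norm_nonneg v) ((norm_nonneg r).trans hr)

section Gradient

variable {ι E : Type*} [NormedAddCommGroup E] [InnerProductSpace ℝ E] [CompleteSpace E]

lemma hasGradientAt_fun_sum {s : Finset ι} {f : ι → E → ℝ} {g : ι → E} {θ : E}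
    (h : ∀ i ∈ s, HasGradientAt (f i) (g i) θ) :
    HasGradientAt (fun θ => ∑ i ∈ s, f i θ) (∑ i ∈ s, g i) θ := by
  rw [hasGradientAt_iff_hasFDerivAt, map_sum]
  exact HasFDerivAt.fun_sum fun i hi => (h i hi).hasFDerivAt

lemma hasGradientAt_const_mul {f : E → ℝ} {g θ : E} (c : ℝ) (h : HasGradientAt f g θ) :
    HasGradientAt (fun θ => c * f θ) (c • g) θ := by
  rw [hasGradientAt_iff_hasFDerivAt, map_smul]
  exact h.hasFDerivAt.const_mul c

lemma hasGradientAt_tsum {u : ι → ℝ} {f : ι → E → ℝ} {g : ι → E → E} (hu : Summable u)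
    (hf : ∀ i θ, HasGradientAt (f i) (g i θ) θ) (hg : ∀ i θ, ‖g i θ‖ ≤ u i) {θ₀ : E}
    (hf₀ : Summable fun i => f i θ₀) (θ : E) :
    HasGradientAt (fun θ => ∑' i, f i θ) (∑' i, g i θ) θ := by
  rw [hasGradientAt_iff_hasFDerivAt]
  have h := hasFDerivAt_tsum hu (fun i θ => (hf i θ).hasFDerivAt)
    (fun i θ => ((InnerProductSpace.toDual ℝ E).norm_map _).trans_le (hg i θ)) hf₀ θ
  exact h.congr_fderiv
    ((InnerProductSpace.toDual ℝ E).toContinuousLinearEquiv.map_tsum (L := .unconditional ι)).symm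

end Gradient

section ExponentialTilting

variable {Ω E F : Type*} [MeasurableSpace Ω] {μ : Measure Ω} [IsFiniteMeasure μ]
  [NormedAddCommGroup E] [NormedSpace ℝ E] [FiniteDimensional ℝ E]
  [NormedAddCommGroup F] [NormedSpace ℝ F]

theorem hasFDerivAt_integral_exp_sub_smul {ℓ : E → Ω → ℝ} {Z : E → Ω → F}
    {ℓ' : E → Ω → E →L[ℝ] ℝ} {Z' : E → Ω → E →L[ℝ] F} {K C C' : ℝ}
    (hℓm : ∀ θ, StronglyMeasurable (ℓ θ)) (hZm : ∀ θ, StronglyMeasurable (Z θ))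
    (hℓ : ∀ θ ω, HasFDerivAt (ℓ · ω) (ℓ' θ ω) θ) (hZ : ∀ θ ω, HasFDerivAt (Z · ω) (Z' θ ω) θ)
    (hℓ' : ∀ θ ω, ‖ℓ' θ ω‖ ≤ K) (hZb : ∀ θ ω, ‖Z θ ω‖ ≤ C) (hZ' : ∀ θ ω, ‖Z' θ ω‖ ≤ C') (θ₀ : E) :
    HasFDerivAt (fun θ => ∫ ω, Real.exp (ℓ θ ω - ℓ θ₀ ω) • Z θ ω ∂μ)
      (∫ ω, Z' θ₀ ω + (ℓ' θ₀ ω).smulRight (Z θ₀ ω) ∂μ) θ₀ := by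
  let f (θ : E) (ω : Ω) : F := Real.exp (ℓ θ ω - ℓ θ₀ ω) • Z θ ω
  let f' (θ : E) (ω : Ω) : E →L[ℝ] F :=
    Real.exp (ℓ θ ω - ℓ θ₀ ω) • (Z' θ ω + (ℓ' θ ω).smulRight (Z θ ω))
  have hf (θ ω) : HasFDerivAt (f · ω) (f' θ ω) θ := by
    refine (((hℓ θ ω).sub_const (ℓ θ₀ ω)).exp.fun_smul (hZ θ ω)).congr_fderiv ?_
    ext v
    simp [f', smul_smul]
  have hfm (θ) : StronglyMeasurable (f θ) :=
    (Real.continuous_exp.comp_stronglyMeasurable ((hℓm θ).sub (hℓm θ₀))).smul (hZm θ)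
  have hf'm : StronglyMeasurable (f' θ₀) := by
    simpa only [(hf θ₀ _).fderiv] using
      stronglyMeasurable_fderiv_param hfm fun ω => (hf θ₀ ω).differentiableAt
  have hlip (θ ω) : |ℓ θ ω - ℓ θ₀ ω| ≤ K * ‖θ - θ₀‖ :=
    convex_univ.norm_image_sub_le_of_norm_hasFDerivWithin_le
      (fun θ _ => (hℓ θ ω).hasFDerivWithinAt) (fun θ _ => hℓ' θ ω) trivial trivial
  have hbound (ω) (θ) (hθ : θ ∈ Metric.ball θ₀ 1) : ‖f' θ ω‖ ≤ Real.exp K * (C' + K * C) := by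
    have hK : 0 ≤ K := (norm_nonneg _).trans (hℓ' θ ω)
    have hexp : ℓ θ ω - ℓ θ₀ ω ≤ K := (le_abs_self _).trans <| (hlip θ ω).trans <|
      mul_le_of_le_one_right hK (mem_ball_iff_norm.1 hθ).le
    rw [norm_smul, Real.norm_of_nonneg (Real.exp_nonneg _)]
    gcongr
    refine norm_add_le_of_le (hZ' θ ω) ?_
    rw [ContinuousLinearMap.norm_smulRight_apply]
    exact mul_le_mul (hℓ' θ ω) (hZb θ ω) (norm_nonneg _) hK
  have hf₀ : Integrable (f θ₀) μ :=
    .of_bound (hfm θ₀).aestronglyMeasurable C (ae_of_all _ fun ω => by simpa [f] using hZb θ₀ ω)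
  simpa [f, f'] using hasFDerivAt_integral_of_dominated_of_fderiv_le
    (Metric.ball_mem_nhds θ₀ one_pos) (.of_forall fun θ => (hfm θ).aestronglyMeasurable) hf₀
    hf'm.aestronglyMeasurable (ae_of_all _ hbound) (integrable_const _)
    (ae_of_all _ fun ω θ _ => hf θ ω)

end ExponentialTilting

section GeometricTail

variable {γ : ℝ}

lemma norm_tsum_sub_sum_range_le {V : Type*} [NormedAddCommGroup V] [CompleteSpace V] {f : ℕ → V}
    {u : ℕ → ℝ} (hu : Summable u) (hf : ∀ n, ‖f n‖ ≤ u n) (N : ℕ) :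
    ‖∑' n, f n - ∑ n ∈ range N, f n‖ ≤ ∑' n, u (n + N) := by
  rw [← (Summable.of_norm_bounded hu hf).sum_add_tsum_nat_add N, add_sub_cancel_left]
  exact tsum_of_norm_bounded ((summable_nat_add_iff N).2 hu).hasSum fun n => hf (n + N)

lemma hasSum_geometric_mul_add (h0 : 0 ≤ γ) (h1 : γ < 1) (a : ℝ) :
    HasSum (fun n : ℕ => γ ^ n * (n + 1 + a)) ((a + 1 / (1 - γ)) / (1 - γ)) := by
  have hlin := hasSum_coe_mul_geometric_of_norm_lt_one (by rwa [Real.norm_of_nonneg h0] : ‖γ‖ < 1)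
  have hγ : 1 - γ ≠ 0 := (sub_pos.2 h1).ne'
  have hvalue : γ / (1 - γ) ^ 2 + (1 + a) * (1 - γ)⁻¹ = (a + 1 / (1 - γ)) / (1 - γ) := by
    field_simp
    ring
  refine (hvalue ▸ hlin.add ((hasSum_geometric_of_lt_one h0 h1).mul_left (1 + a))).congr_fun ?_
  intro n
  ring

lemma sqrt_le_add_div_two_mul_sqrt {x K : ℝ} (hx : 0 ≤ x) (hK : 0 < K) :
    √x ≤ (x + K) / (2 * √K) := by
  rw [le_div_iff₀ (by positivity)]
  have h := two_mul_le_add_sq √x √K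
  rw [Real.sq_sqrt hx, Real.sq_sqrt hK.le] at h
  linarith

lemma summable_geometric_mul_sqrt (h0 : 0 ≤ γ) (h1 : γ < 1) {a : ℝ} (ha : 0 ≤ a) :
    Summable fun n : ℕ => γ ^ n * √(n + 1 + a) := by
  refine .of_nonneg_of_le (fun n => by positivity) (fun n => ?_)
    ((hasSum_geometric_mul_add h0 h1 (a + 1)).summable.div_const 2)
  have h := sqrt_le_add_div_two_mul_sqrt (by positivity : (0 : ℝ) ≤ n + 1 + a) one_pos
  rw [mul_div_assoc]
  gcongr
  simpa [add_assoc] using h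

-- The tangent line of `√` at `K = a + 1 / (1 - γ)`, the mean of `n + 1 + a` under the geometric
-- law, gives the value of Jensen's inequality.
lemma tsum_geometric_mul_sqrt_le (h0 : 0 ≤ γ) (h1 : γ < 1) {a : ℝ} (ha : 0 ≤ a) :
    ∑' n : ℕ, γ ^ n * √(n + 1 + a) ≤ √(a + 1 / (1 - γ)) / (1 - γ) := by
  have hγ : 0 < 1 - γ := sub_pos.2 h1
  obtain ⟨K, hK⟩ : ∃ K, K = a + 1 / (1 - γ) := ⟨_, rfl⟩
  have hK0 : 0 < K := hK ▸ by positivity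
  have hvalue : (a + K + 1 / (1 - γ)) / (1 - γ) / (2 * √K) = √K / (1 - γ) := by
    have hs : √K ≠ 0 := (Real.sqrt_pos.2 hK0).ne'
    rw [add_right_comm, ← hK]
    field_simp
    rw [Real.sq_sqrt hK0.le]
    ring
  have hsum : HasSum (fun n : ℕ => γ ^ n * ((n + 1 + a + K) / (2 * √K))) (√K / (1 - γ)) := by
    refine (hvalue ▸ (hasSum_geometric_mul_add h0 h1 (a + K)).div_const (2 * √K)).congr_fun ?_
    intro n
    ring
  rw [← hK]
  refine hsum.tsum_eq ▸ (summable_geometric_mul_sqrt h0 h1 ha).tsum_le_tsum (fun n => ?_)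
    hsum.summable
  exact mul_le_mul_of_nonneg_left (sqrt_le_add_div_two_mul_sqrt (by positivity) hK0)
    (pow_nonneg h0 n)

end GeometricTail

section ChangeOfMeasure

variable {α β : Type*} {m mα : MeasurableSpace α} [mβ : MeasurableSpace β]

lemma trim_eq_trim_of_map_eq_map (hm : m ≤ mα) {μ μ' : Measure α}
    {T : α → β} (hT : Measurable T) (hmT : m ≤ mβ.comap T) (h : μ.map T = μ'.map T) :
    μ.trim hm = μ'.trim hm := by
  refine @Measure.ext _ m _ _ fun s hs => ?_
  obtain ⟨t, ht, rfl⟩ := hmT s hs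
  rw [trim_measurableSet_eq hm hs, trim_measurableSet_eq hm hs, ← Measure.map_apply hT ht, h,
    Measure.map_apply hT ht]

lemma map_eq_map_of_trim_eq_trim {hm : m ≤ mα} {μ μ' : Measure α}
    {T : α → β} (hT : Measurable[m] T) (h : μ.trim hm = μ'.trim hm) : μ.map T = μ'.map T := by
  ext s hs
  rw [Measure.map_apply (hT.mono hm le_rfl) hs, Measure.map_apply (hT.mono hm le_rfl) hs,
    ← trim_measurableSet_eq hm (hT hs), h, trim_measurableSet_eq hm (hT hs)]

lemma map_withDensity_comp (μ : Measure α) {T : α → β} (hT : Measurable T) {f : β → ENNReal}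
    (hf : Measurable f) : (μ.withDensity fun x => f (T x)).map T = (μ.map T).withDensity f := by
  ext s hs
  rw [Measure.map_apply hT hs, withDensity_apply _ (hT hs), withDensity_apply _ hs,
    setLIntegral_map hs hf hT]

lemma compProd_eq_withDensity {μ μ' : Measure α} [SFinite μ] [SFinite μ'] {κ κ' : Kernel α β}
    [IsSFiniteKernel κ] [IsSFiniteKernel κ'] {f : α → ENNReal} {g : α → β → ENNReal}
    (hf : Measurable f) (hg : Measurable (Function.uncurry g)) (hμ : μ' = μ.withDensity f)
    (hκ : ∀ a, κ' a = (κ a).withDensity (g a)) :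
    μ' ⊗ₘ κ' = (μ ⊗ₘ κ).withDensity fun p => f p.1 * g p.1 p.2 := by
  have hg' : Measurable fun p : α × β => g p.1 p.2 := hg
  refine Measure.ext_of_lintegral _ fun φ hφ => ?_
  rw [lintegral_withDensity_eq_lintegral_mul _ (by fun_prop) hφ, Measure.lintegral_compProd hφ,
    Measure.lintegral_compProd (by fun_prop), hμ,
    lintegral_withDensity_eq_lintegral_mul _ hf hφ.lintegral_kernel_prod_right']
  refine lintegral_congr fun a => ?_
  have hφa : Measurable fun b => φ (a, b) := hφ.comp measurable_prodMk_left
  have hga : Measurable (g a) := hg.comp measurable_prodMk_left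
  simp only [Pi.mul_apply, mul_assoc]
  rw [hκ, lintegral_withDensity_eq_lintegral_mul _ hga hφa, ← lintegral_const_mul _ (hga.mul hφa)]
  rfl

end ChangeOfMeasure

section TrajMeasure

variable {X : ℕ → Type*} [∀ n, MeasurableSpace (X n)]

/-- The σ-algebra of the events that are determined by the coordinates before time `n`; unlike
`Filtration.piLE`, it does not contain the coordinate at time `n` and is trivial for `n = 0`. -/
abbrev strictPast (X : ℕ → Type*) [∀ n, MeasurableSpace (X n)] (n : ℕ) :
    MeasurableSpace (Π n, X n) :=
  Filtration.piFinset (range n)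

lemma strictPast_le (n : ℕ) : strictPast X n ≤ MeasurableSpace.pi :=
  Filtration.piFinset.le _

lemma measurable_eval_strictPast {m n : ℕ} (h : m < n) :
    Measurable[strictPast X n] fun x : Π n, X n => x m := by
  let e : (Π i : range n, X i) → X m := fun y => y ⟨m, mem_range.2 h⟩
  exact (show Measurable e from measurable_pi_apply _).comp (comap_measurable (range n).restrict)

lemma strictPast_le_of_measurable_eval {m : MeasurableSpace (Π n, X n)} {n : ℕ}
    (h : ∀ i < n, Measurable[m] fun x : Π n, X n => x i) : strictPast X n ≤ m :=
  Measurable.comap_le (measurable_pi_lambda _ fun i => h i (mem_range.1 i.2))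

lemma strictPast_mono : Monotone (strictPast X) := fun _ _ hmn =>
  strictPast_le_of_measurable_eval fun _ hi => measurable_eval_strictPast (hi.trans_le hmn)

lemma integrable_of_stronglyMeasurable_strictPast {P : Measure (Π n, X n)} [IsFiniteMeasure P]
    {F : Type*} [NormedAddCommGroup F] {n : ℕ} {f : (Π n, X n) → F} {C : ℝ}
    (hf : StronglyMeasurable[strictPast X n] f) (hC : ∀ x, ‖f x‖ ≤ C) : Integrable f P :=
  .of_bound (hf.mono (strictPast_le n)).aestronglyMeasurable C (ae_of_all _ hC)

lemma measurable_frestrictLe_strictPast (n : ℕ) :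
    Measurable[strictPast X (n + 1)] (Preorder.frestrictLe (π := X) n) :=
  @measurable_pi_lambda _ _ _ (strictPast X (n + 1)) _ _ fun i =>
    measurable_eval_strictPast (Nat.lt_succ_of_le (mem_Iic.1 i.2))

lemma strictPast_le_comap_frestrictLe_prodMk (n : ℕ) :
    strictPast X (n + 2) ≤ MeasurableSpace.comap
      (fun x : Π n, X n => (Preorder.frestrictLe (π := X) n x, x (n + 1))) inferInstance := by
  refine strictPast_le_of_measurable_eval fun i hi => ?_
  have hT := comap_measurable (m := inferInstance)
    fun x : Π n, X n => (Preorder.frestrictLe (π := X) n x, x (n + 1))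
  rcases Nat.lt_succ_iff_lt_or_eq.1 hi with hi | rfl
  · let e : (Π i : Iic n, X i) → X i := fun y => y ⟨i, mem_Iic.2 (Nat.lt_succ_iff.1 hi)⟩
    exact (show Measurable e from measurable_pi_apply _).comp (measurable_fst.comp hT)
  · exact measurable_snd.comp hT

variable {μ μ' : Measure (X 0)}
  {κ κ' : (n : ℕ) → Kernel (Π i : Iic n, X i) (X (n + 1))}
  [∀ n, IsMarkovKernel (κ n)] [∀ n, IsMarkovKernel (κ' n)]

lemma map_eval_zero_trajMeasure : (Kernel.trajMeasure μ κ).map (fun x => x 0) = μ := by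
  let e : (Π i : Iic 0, X i) → X 0 := fun y => y ⟨0, mem_Iic.2 le_rfl⟩
  have he : Measurable e := measurable_pi_apply _
  have hcomp : (fun x : Π n, X n => x 0) = e ∘ Preorder.frestrictLe 0 := rfl
  rw [hcomp, ← Measure.map_map he (by fun_prop), Kernel.trajMeasure,
    Measure.map_comp _ _ (by fun_prop), Kernel.traj_map_frestrictLe, Kernel.partialTraj_self,
    Measure.id_comp]
  exact (Measure.map_map he (MeasurableEquiv.measurable _)).trans Measure.map_id

variable [IsProbabilityMeasure μ] [IsProbabilityMeasure μ']

theorem trim_trajMeasure_eq_trim_withDensity {r : (n : ℕ) → X n → ENNReal}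
    (hr : ∀ n, Measurable (r n)) (hμ : μ' = μ.withDensity (r 0))
    (hκ : ∀ n h, κ' n h = (κ n h).withDensity (r (n + 1))) (n : ℕ) :
    (Kernel.trajMeasure μ' κ').trim (strictPast_le n) =
      ((Kernel.trajMeasure μ κ).withDensity fun x => ∏ i ∈ range n, r i (x i)).trim
        (strictPast_le n) := by
  induction n with
  | zero =>
    refine trim_eq_trim_of_map_eq_map _ (measurable_const (a := ()))
      (strictPast_le_of_measurable_eval fun _ hi => absurd hi (Nat.not_lt_zero _)) ?_
    simp
  | succ n ih =>
    cases n with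
    | zero =>
      refine trim_eq_trim_of_map_eq_map _ (measurable_pi_apply 0)
        (strictPast_le_of_measurable_eval fun i hi => ?_) ?_
      · obtain rfl := Nat.lt_one_iff.1 hi
        exact comap_measurable _
      · simp only [zero_add, prod_range_one]
        rw [map_withDensity_comp _ (measurable_pi_apply 0) (hr 0), map_eval_zero_trajMeasure,
          map_eval_zero_trajMeasure, hμ]
    | succ n =>
      let L : (Π i : Iic n, X i) → ENNReal := fun y => ∏ i : Iic n, r i (y i)
      have hL : Measurable L := by fun_prop
      have hprod (x : Π n, X n) :
          ∏ i ∈ range (n + 1), r i (x i) = L (Preorder.frestrictLe n x) := by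
        rw [Nat.range_succ_eq_Iic]
        exact (prod_coe_sort (Iic n) fun i => r i (x i)).symm
      have hT : Measurable fun x : Π n, X n => (Preorder.frestrictLe (π := X) n x, x (n + 1)) := by
        fun_prop
      have hpast := map_eq_map_of_trim_eq_trim (measurable_frestrictLe_strictPast n) ih
      simp_rw [hprod] at hpast
      rw [map_withDensity_comp _ (by fun_prop) hL] at hpast
      refine trim_eq_trim_of_map_eq_map _ hT (strictPast_le_comap_frestrictLe_prodMk n) ?_
      rw [← Kernel.map_frestrictLe_trajMeasure_compProd_eq_map_trajMeasure,
        compProd_eq_withDensity (g := fun _ => r (n + 1)) hL (by fun_prop) hpast (hκ n),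
        Kernel.map_frestrictLe_trajMeasure_compProd_eq_map_trajMeasure,
        ← map_withDensity_comp _ hT (by fun_prop)]
      simp_rw [prod_range_succ _ (n + 1), hprod]

theorem integral_trajMeasure_eq_integral_smul {r : (n : ℕ) → X n → ENNReal}
    (hr : ∀ n, Measurable (r n)) (hr_top : ∀ n x, r n x ≠ ⊤) (hμ : μ' = μ.withDensity (r 0))
    (hκ : ∀ n h, κ' n h = (κ n h).withDensity (r (n + 1))) {n : ℕ}
    {F : Type*} [NormedAddCommGroup F] [NormedSpace ℝ F] {f : (Π n, X n) → F}
    (hf : StronglyMeasurable[strictPast X n] f) :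
    ∫ x, f x ∂(Kernel.trajMeasure μ' κ') =
      ∫ x, (∏ i ∈ range n, r i (x i)).toReal • f x ∂(Kernel.trajMeasure μ κ) := by
  rw [integral_trim (strictPast_le n) hf, trim_trajMeasure_eq_trim_withDensity hr hμ hκ,
    ← integral_trim (strictPast_le n) hf,
    integral_withDensity_eq_integral_toReal_smul (by fun_prop)]
  exact ae_of_all _ fun x => ENNReal.prod_lt_top fun i _ => (hr_top i (x i)).lt_top

end TrajMeasure

namespace PolicyFamily

variable {S A : Type*} [MeasurableSpace S] [MeasurableSpace A] {ν : Measure A} {d : ℕ}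
  {π : PolicyFamily S ν d} {G₁ G₂ : ℝ}

lemma measurable_logDens (π : PolicyFamily S ν d) (θ : EuclideanSpace ℝ (Fin d)) :
    Measurable fun z : S × A => π.logDens z.1 z.2 θ :=
  (π.measurable_dens θ).log

namespace LS

lemma differentiable_logDens (hLS : π.LS G₁ G₂) (s : S) (a : A) :
    Differentiable ℝ (π.logDens s a) :=
  (π.differentiable_dens s a).log fun θ => (hLS.dens_pos θ s a).ne'

lemma stronglyMeasurable_gradient_logDens (hLS : π.LS G₁ G₂) (θ : EuclideanSpace ℝ (Fin d)) :
    StronglyMeasurable fun z : S × A => gradient (π.logDens z.1 z.2) θ :=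
  stronglyMeasurable_gradient_param (f := fun θ (z : S × A) => π.logDens z.1 z.2 θ)
    (fun θ => (π.measurable_logDens θ).stronglyMeasurable)
    fun z => hLS.differentiable_logDens z.1 z.2 θ

lemma kernel_eq_withDensity [SigmaFinite ν] (hLS : π.LS G₁ G₂) (θ θ' : EuclideanSpace ℝ (Fin d))
    (s : S) :
    π.kernel θ' s = (π.kernel θ s).withDensity
      fun a => ENNReal.ofReal (Real.exp (π.logDens s a θ' - π.logDens s a θ)) := by
  have hdens (θ) : Measurable (Function.uncurry fun s a => ENNReal.ofReal (π.dens θ s a)) :=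
    (π.measurable_dens θ).ennreal_ofReal
  have hlog (θ) : Measurable fun a => π.logDens s a θ :=
    (π.measurable_logDens θ).comp measurable_prodMk_left
  have hratio (a : A) :
      π.dens θ' s a = π.dens θ s a * Real.exp (π.logDens s a θ' - π.logDens s a θ) := by
    have hpos := hLS.dens_pos θ s a
    rw [Real.exp_sub, logDens, logDens, Real.exp_log (hLS.dens_pos θ' s a), Real.exp_log hpos,
      mul_div_cancel₀ _ hpos.ne']
  rw [kernel, kernel, Kernel.withDensity_apply _ (hdens θ'), Kernel.withDensity_apply _ (hdens θ),
    ← withDensity_mul _ ((hdens θ).of_uncurry_left (x := s)) (by fun_prop)]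
  congr with a
  rw [Pi.mul_apply, ← ENNReal.ofReal_mul (π.dens_nonneg θ s a), hratio a]

end LS

end PolicyFamily

namespace MDP

open scoped RealInnerProductSpace

variable {S A : Type*} [MeasurableSpace S] [MeasurableSpace A] {ν : Measure A} {d : ℕ}
  {π : PolicyFamily S ν d} {G₁ G₂ : ℝ}

section Score

/-- The log-likelihood `log p(τ|π_θ)` of the trajectory truncated at horizon `n`, up to the terms
that do not depend on `θ`; its gradient is the score. -/
noncomputable def truncLogLik (π : PolicyFamily S ν d) (n : ℕ) (τ : ℕ → S × A)
    (θ : EuclideanSpace ℝ (Fin d)) : ℝ :=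
  ∑ h ∈ range n, π.logDens (τ h).1 (τ h).2 θ

lemma stronglyMeasurable_truncLogLik (π : PolicyFamily S ν d) (n : ℕ)
    (θ : EuclideanSpace ℝ (Fin d)) :
    StronglyMeasurable[strictPast (fun _ => S × A) n] fun τ => truncLogLik π n τ θ :=
  stronglyMeasurable_fun_sum _ fun _ hh =>
    (π.measurable_logDens θ).stronglyMeasurable.comp_measurable
      (measurable_eval_strictPast (mem_range.1 hh))

lemma stronglyMeasurable_truncScore (hLS : π.LS G₁ G₂) (n : ℕ) (θ : EuclideanSpace ℝ (Fin d)) :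
    StronglyMeasurable[strictPast (fun _ => S × A) n] fun τ => truncScore π n τ θ :=
  stronglyMeasurable_fun_sum _ fun _ hh =>
    (hLS.stronglyMeasurable_gradient_logDens θ).comp_measurable
      (measurable_eval_strictPast (mem_range.1 hh))

lemma hasGradientAt_truncLogLik (hLS : π.LS G₁ G₂) (n : ℕ) (τ : ℕ → S × A)
    (θ : EuclideanSpace ℝ (Fin d)) :
    HasGradientAt (truncLogLik π n τ) (truncScore π n τ θ) θ :=
  hasGradientAt_fun_sum fun h _ => (hLS.differentiable_logDens (τ h).1 (τ h).2 θ).hasGradientAt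

lemma gradient_truncLogLik (hLS : π.LS G₁ G₂) (n : ℕ) (τ : ℕ → S × A) :
    gradient (truncLogLik π n τ) = truncScore π n τ :=
  funext fun θ => (hasGradientAt_truncLogLik hLS n τ θ).gradient

lemma hasFDerivAt_truncScore (hLS : π.LS G₁ G₂) (n : ℕ) (τ : ℕ → S × A)
    (θ : EuclideanSpace ℝ (Fin d)) :
    HasFDerivAt (truncScore π n τ) (hessian (truncLogLik π n τ) θ) θ := by
  rw [hessian, gradient_truncLogLik hLS]
  exact (DifferentiableAt.fun_sum fun h _ =>
    hLS.differentiable_gradient (τ h).1 (τ h).2 θ).hasFDerivAt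

lemma norm_truncScore_le (hLS : π.LS G₁ G₂) (n : ℕ) (τ : ℕ → S × A)
    (θ : EuclideanSpace ℝ (Fin d)) : ‖truncScore π n τ θ‖ ≤ n * G₁ := by
  simpa [truncScore] using
    norm_sum_le_of_le (range n) fun h _ => hLS.norm_gradient_le θ (τ h).1 (τ h).2

lemma norm_hessian_truncLogLik_le (hLS : π.LS G₁ G₂) (n : ℕ) (τ : ℕ → S × A)
    (θ : EuclideanSpace ℝ (Fin d)) : ‖hessian (truncLogLik π n τ) θ‖ ≤ n * G₂ := by
  have hsum : hessian (truncLogLik π n τ) θ =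
      ∑ h ∈ range n, hessian (π.logDens (τ h).1 (τ h).2) θ :=
    (hasFDerivAt_truncScore hLS n τ θ).unique <| HasFDerivAt.fun_sum fun h _ =>
      (hLS.differentiable_gradient (τ h).1 (τ h).2 θ).hasFDerivAt
  simpa [hsum] using
    norm_sum_le_of_le (range n) fun h _ => hLS.norm_hessian_le θ (τ h).1 (τ h).2

lemma norm_truncScore_succ_sq_le (hLS : π.LS G₁ G₂) (n : ℕ) (τ : ℕ → S × A)
    (θ : EuclideanSpace ℝ (Fin d)) :
    ‖truncScore π (n + 1) τ θ‖ ^ 2 ≤ G₁ ^ 2 +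
      (2 * ⟪truncScore π (n + 1) τ θ, truncScore π n τ θ⟫ - ‖truncScore π n τ θ‖ ^ 2) := by
  have hstep : truncScore π (n + 1) τ θ - truncScore π n τ θ =
      gradient (π.logDens (τ n).1 (τ n).2) θ :=
    sum_range_succ_sub_sum _
  have hG := pow_le_pow_left₀ (norm_nonneg _) (hLS.norm_gradient_le θ (τ n).1 (τ n).2) 2
  rw [← hstep, norm_sub_sq_real] at hG
  linarith

end Score

section ScoreIdentity

variable [SigmaFinite ν]

instance (M : MDP S A) (π : PolicyFamily S ν d) (θ : EuclideanSpace ℝ (Fin d)) :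
    IsProbabilityMeasure (M.trajLaw π θ) := by
  unfold trajLaw; infer_instance

lemma stepKernel_apply (M : MDP S A) (π : PolicyFamily S ν d) (θ : EuclideanSpace ℝ (Fin d))
    (z : S × A) : M.stepKernel π θ z = M.P z ⊗ₘ π.kernel θ := by
  rw [stepKernel, Kernel.compProd_apply_eq_compProd_sectR]
  rfl

lemma compProd_kernel_eq_withDensity (hLS : π.LS G₁ G₂) (θ θ' : EuclideanSpace ℝ (Fin d))
    (μ : Measure S) [SFinite μ] :
    μ ⊗ₘ π.kernel θ' = (μ ⊗ₘ π.kernel θ).withDensity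
      fun z => ENNReal.ofReal (Real.exp (π.logDens z.1 z.2 θ' - π.logDens z.1 z.2 θ)) := by
  have hlog := π.measurable_logDens
  simpa using compProd_eq_withDensity
    (g := fun s a => ENNReal.ofReal (Real.exp (π.logDens s a θ' - π.logDens s a θ)))
    measurable_one (by unfold Function.uncurry; fun_prop) withDensity_one.symm
    (hLS.kernel_eq_withDensity θ θ')

lemma integral_trajLaw_eq_integral_exp_smul {F : Type*} [NormedAddCommGroup F] [NormedSpace ℝ F]
    (M : MDP S A) (hLS : π.LS G₁ G₂) (θ θ' : EuclideanSpace ℝ (Fin d)) {n : ℕ}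
    {f : (ℕ → S × A) → F} (hf : StronglyMeasurable[strictPast (fun _ => S × A) n] f) :
    ∫ τ, f τ ∂(M.trajLaw π θ') =
      ∫ τ, Real.exp (truncLogLik π n τ θ' - truncLogLik π n τ θ) • f τ ∂(M.trajLaw π θ) := by
  have hlog := π.measurable_logDens
  rw [trajLaw, trajLaw, integral_trajMeasure_eq_integral_smul (κ := M.historyKernel π θ)
    (r := fun _ z => ENNReal.ofReal (Real.exp (π.logDens z.1 z.2 θ' - π.logDens z.1 z.2 θ)))
    (fun _ => by fun_prop) (fun _ _ => ENNReal.ofReal_ne_top)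
    (compProd_kernel_eq_withDensity hLS θ θ' M.ρ) (fun n h => ?_) hf]
  · simp_rw [truncLogLik, ← sum_sub_distrib, Real.exp_sum, ENNReal.toReal_prod,
      ENNReal.toReal_ofReal (Real.exp_nonneg _)]
  · simp only [historyKernel, Kernel.comap_apply, stepKernel_apply]
    exact compProd_kernel_eq_withDensity hLS θ θ' _

theorem hasFDerivAt_integral_trajLaw {F : Type*} [NormedAddCommGroup F] [NormedSpace ℝ F]
    (M : MDP S A) (hLS : π.LS G₁ G₂) {n : ℕ}
    {Z : EuclideanSpace ℝ (Fin d) → (ℕ → S × A) → F}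
    {Z' : EuclideanSpace ℝ (Fin d) → (ℕ → S × A) → EuclideanSpace ℝ (Fin d) →L[ℝ] F} {C C' : ℝ}
    (hZm : ∀ θ, StronglyMeasurable[strictPast (fun _ => S × A) n] (Z θ))
    (hZ : ∀ θ τ, HasFDerivAt (Z · τ) (Z' θ τ) θ) (hZb : ∀ θ τ, ‖Z θ τ‖ ≤ C)
    (hZ' : ∀ θ τ, ‖Z' θ τ‖ ≤ C') (θ : EuclideanSpace ℝ (Fin d)) :
    HasFDerivAt (fun θ => ∫ τ, Z θ τ ∂(M.trajLaw π θ))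
      (∫ τ, Z' θ τ + (innerSL ℝ (truncScore π n τ θ)).smulRight (Z θ τ) ∂(M.trajLaw π θ)) θ := by
  simp_rw [fun θ' => M.integral_trajLaw_eq_integral_exp_smul hLS θ θ' (hZm θ')]
  exact hasFDerivAt_integral_exp_sub_smul
    (fun θ => (stronglyMeasurable_truncLogLik π n θ).mono (strictPast_le n))
    (fun θ => (hZm θ).mono (strictPast_le n))
    (fun θ τ => (hasGradientAt_truncLogLik hLS n τ θ).hasFDerivAt) hZ
    (fun θ τ => ((InnerProductSpace.toDual ℝ _).norm_map _).trans_le (norm_truncScore_le hLS n τ θ))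
    hZb hZ' θ

theorem hasGradientAt_integral_trajLaw (M : MDP S A) (hLS : π.LS G₁ G₂) {n : ℕ}
    {Z : (ℕ → S × A) → ℝ} {C : ℝ} (hZm : StronglyMeasurable[strictPast (fun _ => S × A) n] Z)
    (hZb : ∀ τ, ‖Z τ‖ ≤ C) (θ : EuclideanSpace ℝ (Fin d)) :
    HasGradientAt (fun θ => ∫ τ, Z τ ∂(M.trajLaw π θ))
      (∫ τ, Z τ • truncScore π n τ θ ∂(M.trajLaw π θ)) θ := by
  rw [hasGradientAt_iff_hasFDerivAt]
  refine (M.hasFDerivAt_integral_trajLaw hLS (fun _ => hZm) (fun θ τ => hasFDerivAt_const (Z τ) θ)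
    (fun _ => hZb) (fun _ _ => norm_zero.le) θ).congr_fderiv ?_
  refine Eq.trans ?_ ((InnerProductSpace.toDual ℝ _).toContinuousLinearEquiv.integral_comp_comm
    fun τ => Z τ • truncScore π n τ θ)
  congr with τ v
  simp [mul_comm]

lemma integrable_rankOne_truncScore (M : MDP S A) (hLS : π.LS G₁ G₂) {n : ℕ}
    {Z : (ℕ → S × A) → EuclideanSpace ℝ (Fin d)} {C : ℝ}
    (hZm : StronglyMeasurable[strictPast (fun _ => S × A) n] Z) (hZb : ∀ τ, ‖Z τ‖ ≤ C)
    (θ : EuclideanSpace ℝ (Fin d)) :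
    Integrable (fun τ => InnerProductSpace.rankOne ℝ (Z τ) (truncScore π n τ θ))
      (M.trajLaw π θ) := by
  refine integrable_of_stronglyMeasurable_strictPast (n := n) (C := C * (n * G₁))
    (stronglyMeasurable_rankOne hZm (stronglyMeasurable_truncScore hLS n θ)) fun τ => ?_
  rw [InnerProductSpace.norm_rankOne]
  exact mul_le_mul (hZb τ) (norm_truncScore_le hLS n τ θ) (norm_nonneg _)
    ((norm_nonneg _).trans (hZb τ))

-- Both sides are the trace of the derivative of `θ ↦ E[Z]`, computed by the score identity with
-- the first `n + 1` and the first `n` steps.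
lemma integral_inner_truncScore_succ (M : MDP S A) (hLS : π.LS G₁ G₂) {n : ℕ}
    {Z : (ℕ → S × A) → EuclideanSpace ℝ (Fin d)} {C : ℝ}
    (hZm : StronglyMeasurable[strictPast (fun _ => S × A) n] Z) (hZb : ∀ τ, ‖Z τ‖ ≤ C)
    (θ : EuclideanSpace ℝ (Fin d)) :
    ∫ τ, ⟪truncScore π (n + 1) τ θ, Z τ⟫ ∂(M.trajLaw π θ) =
      ∫ τ, ⟪truncScore π n τ θ, Z τ⟫ ∂(M.trajLaw π θ) := by
  let E := EuclideanSpace ℝ (Fin d)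
  let trace : (E →L[ℝ] E) →L[ℝ] ℝ :=
    (LinearMap.trace ℝ E ∘ₗ ContinuousLinearMap.coeLM ℝ).toContinuousLinearMap
  have hZm' (m) (hm : n ≤ m) : StronglyMeasurable[strictPast (fun _ => S × A) m] Z :=
    hZm.mono (strictPast_mono hm)
  have hderiv (m) (hm : n ≤ m) : HasFDerivAt (fun θ => ∫ τ, Z τ ∂(M.trajLaw π θ))
      (∫ τ, InnerProductSpace.rankOne ℝ (Z τ) (truncScore π m τ θ) ∂(M.trajLaw π θ)) θ := by
    simpa only [zero_add, InnerProductSpace.rankOne_def] using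
      M.hasFDerivAt_integral_trajLaw hLS (fun _ => hZm' m hm)
        (fun θ τ => hasFDerivAt_const (Z τ) θ) (fun _ => hZb) (fun _ _ => norm_zero.le) θ
  have htrace (m) (hm : n ≤ m) :
      trace (∫ τ, InnerProductSpace.rankOne ℝ (Z τ) (truncScore π m τ θ) ∂(M.trajLaw π θ)) =
        ∫ τ, ⟪truncScore π m τ θ, Z τ⟫ ∂(M.trajLaw π θ) := by
    rw [← trace.integral_comp_comm (M.integrable_rankOne_truncScore hLS (hZm' m hm) hZb θ)]
    exact integral_congr_ae (ae_of_all _ fun τ => InnerProductSpace.trace_rankOne _ _)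
  rw [← htrace (n + 1) n.le_succ, ← htrace n le_rfl,
    (hderiv (n + 1) n.le_succ).unique (hderiv n le_rfl)]

lemma memLp_truncScore (M : MDP S A) (hLS : π.LS G₁ G₂) (p : ENNReal) (n : ℕ)
    (θ : EuclideanSpace ℝ (Fin d)) : MemLp (fun τ => truncScore π n τ θ) p (M.trajLaw π θ) :=
  .of_bound ((stronglyMeasurable_truncScore hLS n θ).mono (strictPast_le n)).aestronglyMeasurable
    (n * G₁) (ae_of_all _ fun τ => norm_truncScore_le hLS n τ θ)

theorem integral_norm_truncScore_sq_le (M : MDP S A) (hLS : π.LS G₁ G₂) (n : ℕ)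
    (θ : EuclideanSpace ℝ (Fin d)) :
    ∫ τ, ‖truncScore π n τ θ‖ ^ 2 ∂(M.trajLaw π θ) ≤ n * G₁ ^ 2 := by
  induction n with
  | zero => simp [truncScore]
  | succ n ih =>
    have hsq (m) := (M.memLp_truncScore hLS 2 m θ).integrable_norm_pow two_ne_zero
    have hinner : Integrable (fun τ => ⟪truncScore π (n + 1) τ θ, truncScore π n τ θ⟫)
        (M.trajLaw π θ) :=
      .mono' ((hsq (n + 1)).add (hsq n))
        ((M.memLp_truncScore hLS 2 (n + 1) θ).1.inner (M.memLp_truncScore hLS 2 n θ).1)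
        (ae_of_all _ fun τ => (norm_inner_le_norm _ _).trans <| by
          dsimp
          nlinarith [sq_nonneg (‖truncScore π (n + 1) τ θ‖ - ‖truncScore π n τ θ‖)])
    have hcross := M.integral_inner_truncScore_succ hLS (stronglyMeasurable_truncScore hLS n θ)
      (fun τ => norm_truncScore_le hLS n τ θ) θ
    simp_rw [real_inner_self_eq_norm_sq] at hcross
    have hle := integral_mono (hsq (n + 1))
      ((integrable_const _).add ((hinner.const_mul 2).sub (hsq n)))
      fun τ => norm_truncScore_succ_sq_le hLS n τ θ
    rw [integral_add' (integrable_const _) ((hinner.const_mul 2).sub (hsq n)),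
      integral_sub' (hinner.const_mul 2) (hsq n), integral_const_mul, hcross, integral_const,
      probReal_univ, one_smul] at hle
    push_cast
    linarith

theorem integral_norm_truncScore_le (M : MDP S A) (hLS : π.LS G₁ G₂) (n : ℕ)
    (θ : EuclideanSpace ℝ (Fin d)) :
    ∫ τ, ‖truncScore π n τ θ‖ ∂(M.trajLaw π θ) ≤ G₁ * √n := by
  have hmem : MemLp (fun τ => ‖truncScore π n τ θ‖) 2 (M.trajLaw π θ) :=
    (M.memLp_truncScore hLS 2 n θ).norm
  have hvar := variance_nonneg (fun τ => ‖truncScore π n τ θ‖) (M.trajLaw π θ)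
  rw [variance_eq_sub hmem, sub_nonneg] at hvar
  refine abs_le_of_sq_le_sq' ((hvar.trans (M.integral_norm_truncScore_sq_le hLS n θ)).trans_eq ?_)
    (mul_nonneg hLS.G₁_pos.le (Real.sqrt_nonneg _)) |>.2
  rw [mul_pow, Real.sq_sqrt n.cast_nonneg, mul_comm]

end ScoreIdentity

variable (M : MDP S A)

lemma stronglyMeasurable_reward (t : ℕ) :
    StronglyMeasurable[strictPast (fun _ => S × A) (t + 1)] fun τ => M.R (τ t).1 (τ t).2 :=
  M.measurable_R.stronglyMeasurable.comp_measurable (measurable_eval_strictPast t.lt_succ_self)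

section MeanReward

variable [SigmaFinite ν]

/-- The expected reward `E[R(s_t, a_t)]` at time `t`; `J` and `truncJ` are its discounted sums. -/
noncomputable def meanReward (π : PolicyFamily S ν d) (t : ℕ) (θ : EuclideanSpace ℝ (Fin d)) : ℝ :=
  ∫ τ, M.R (τ t).1 (τ t).2 ∂(M.trajLaw π θ)

lemma norm_meanReward_le (π : PolicyFamily S ν d) (t : ℕ) (θ : EuclideanSpace ℝ (Fin d)) :
    ‖M.meanReward π t θ‖ ≤ M.Rmax := by
  simpa [meanReward] using norm_integral_le_of_norm_le_const (μ := M.trajLaw π θ)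
    (f := fun τ => M.R (τ t).1 (τ t).2) (ae_of_all _ fun τ => M.abs_R_le (τ t).1 (τ t).2)

lemma hasGradientAt_meanReward (hLS : π.LS G₁ G₂) (t : ℕ) (θ : EuclideanSpace ℝ (Fin d)) :
    HasGradientAt (M.meanReward π t)
      (∫ τ, M.R (τ t).1 (τ t).2 • truncScore π (t + 1) τ θ ∂(M.trajLaw π θ)) θ :=
  M.hasGradientAt_integral_trajLaw hLS (M.stronglyMeasurable_reward t)
    (fun τ => M.abs_R_le (τ t).1 (τ t).2) θ

lemma hasFDerivAt_gradient_meanReward (hLS : π.LS G₁ G₂) (t : ℕ)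
    (θ : EuclideanSpace ℝ (Fin d)) :
    HasFDerivAt (gradient (M.meanReward π t))
      (∫ τ, M.R (τ t).1 (τ t).2 • hessian (truncLogLik π (t + 1) τ) θ +
        InnerProductSpace.rankOne ℝ (M.R (τ t).1 (τ t).2 • truncScore π (t + 1) τ θ)
          (truncScore π (t + 1) τ θ) ∂(M.trajLaw π θ)) θ := by
  rw [funext fun θ => (M.hasGradientAt_meanReward hLS t θ).gradient]
  exact M.hasFDerivAt_integral_trajLaw hLS
    (fun θ => (M.stronglyMeasurable_reward t).smul (stronglyMeasurable_truncScore hLS (t + 1) θ))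
    (fun θ τ => (hasFDerivAt_truncScore hLS (t + 1) τ θ).const_smul (M.R (τ t).1 (τ t).2))
    (fun θ τ => norm_smul_le_of_le (M.abs_R_le _ _) (norm_truncScore_le hLS (t + 1) τ θ))
    (fun θ τ => norm_smul_le_of_le (M.abs_R_le _ _) (norm_hessian_truncLogLik_le hLS (t + 1) τ θ)) θ

lemma norm_gradient_meanReward_le (hLS : π.LS G₁ G₂) (t : ℕ) (θ : EuclideanSpace ℝ (Fin d)) :
    ‖gradient (M.meanReward π t) θ‖ ≤ M.Rmax * G₁ * √(t + 1) := by
  rw [(M.hasGradientAt_meanReward hLS t θ).gradient]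
  calc _ ≤ ∫ τ, M.Rmax * ‖truncScore π (t + 1) τ θ‖ ∂(M.trajLaw π θ) :=
        norm_integral_le_of_norm_le
          (((M.memLp_truncScore hLS 1 (t + 1) θ).integrable le_rfl).norm.const_mul _)
          (ae_of_all _ fun τ => norm_smul_le_of_le (M.abs_R_le _ _) le_rfl)
    _ ≤ M.Rmax * (G₁ * √((t + 1 : ℕ) : ℝ)) := by
        rw [integral_const_mul]
        exact mul_le_mul_of_nonneg_left (M.integral_norm_truncScore_le hLS (t + 1) θ)
          M.Rmax_pos.le
    _ = M.Rmax * G₁ * √(t + 1) := by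
        push_cast
        ring

lemma norm_hessian_meanReward_le (hLS : π.LS G₁ G₂) (t : ℕ) (θ : EuclideanSpace ℝ (Fin d)) :
    ‖hessian (M.meanReward π t) θ‖ ≤ M.Rmax * (G₂ + G₁ ^ 2) * (t + 1) := by
  rw [hessian, (M.hasFDerivAt_gradient_meanReward hLS t θ).fderiv]
  have hsq := (M.memLp_truncScore hLS 2 (t + 1) θ).integrable_norm_pow two_ne_zero
  calc _ ≤ ∫ τ, M.Rmax * ((t + 1 : ℕ) * G₂) + M.Rmax * ‖truncScore π (t + 1) τ θ‖ ^ 2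
          ∂(M.trajLaw π θ) := by
        refine norm_integral_le_of_norm_le ((integrable_const _).add (hsq.const_mul _))
          (ae_of_all _ fun τ => norm_add_le_of_le
            (norm_smul_le_of_le (M.abs_R_le _ _) (norm_hessian_truncLogLik_le hLS (t + 1) τ θ)) ?_)
        rw [InnerProductSpace.norm_rankOne, pow_two, ← mul_assoc]
        exact mul_le_mul_of_nonneg_right (norm_smul_le_of_le (M.abs_R_le _ _) le_rfl)
          (norm_nonneg _)
    _ ≤ M.Rmax * ((t + 1 : ℕ) * G₂) + M.Rmax * ((t + 1 : ℕ) * G₁ ^ 2) := by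
        rw [integral_add (integrable_const _) (hsq.const_mul _), integral_const,
          probReal_univ, one_smul, integral_const_mul]
        gcongr
        · exact M.Rmax_pos.le
        · exact M.integral_norm_truncScore_sq_le hLS (t + 1) θ
    _ = M.Rmax * (G₂ + G₁ ^ 2) * (t + 1) := by
        push_cast
        ring

end MeanReward

section Objective

lemma norm_pow_smul_le {V : Type*} [NormedAddCommGroup V] [NormedSpace ℝ V] {v : V} {c : ℝ}
    (hv : ‖v‖ ≤ c) (t : ℕ) : ‖M.γ ^ t • v‖ ≤ M.γ ^ t * c :=
  norm_smul_le_of_le (Real.norm_of_nonneg (pow_nonneg M.γ_pos.le t)).le hv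

variable [SigmaFinite ν]

lemma integrable_discounted_reward (π : PolicyFamily S ν d) (t : ℕ)
    (θ : EuclideanSpace ℝ (Fin d)) :
    Integrable (fun τ => M.γ ^ t * M.R (τ t).1 (τ t).2) (M.trajLaw π θ) :=
  (integrable_of_stronglyMeasurable_strictPast (M.stronglyMeasurable_reward t)
    fun τ => M.abs_R_le (τ t).1 (τ t).2).const_mul _

lemma truncJ_eq_sum (π : PolicyFamily S ν d) (H : ℕ) :
    M.truncJ π H = fun θ => ∑ t ∈ range H, M.γ ^ t * M.meanReward π t θ := by
  ext θ
  rw [truncJ, integral_finsetSum _ fun t _ => M.integrable_discounted_reward π t θ]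
  simp_rw [integral_const_mul, meanReward]

lemma J_eq_tsum (π : PolicyFamily S ν d) :
    M.J π = fun θ => ∑' t, M.γ ^ t * M.meanReward π t θ := by
  ext θ
  have hbound (t) : ∫ τ, ‖M.γ ^ t * M.R (τ t).1 (τ t).2‖ ∂(M.trajLaw π θ) ≤
      M.γ ^ t * M.Rmax := by
    simpa using integral_mono (M.integrable_discounted_reward π t θ).norm
      (integrable_const (M.γ ^ t * M.Rmax)) fun τ => M.norm_pow_smul_le (M.abs_R_le _ _) t
  rw [J, ← integral_tsum_of_summable_integral_norm (M.integrable_discounted_reward π · θ)]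
  · simp_rw [integral_const_mul, meanReward]
  · exact .of_nonneg_of_le (fun t => integral_nonneg fun _ => norm_nonneg _) hbound
      ((summable_geometric_of_lt_one M.γ_pos.le M.γ_lt_one).mul_right _)

lemma summable_discounted_meanReward (π : PolicyFamily S ν d) (θ : EuclideanSpace ℝ (Fin d)) :
    Summable fun t => M.γ ^ t * M.meanReward π t θ :=
  .of_norm_bounded ((summable_geometric_of_lt_one M.γ_pos.le M.γ_lt_one).mul_right M.Rmax)
    fun t => M.norm_pow_smul_le (M.norm_meanReward_le π t θ) t

lemma hasGradientAt_discounted_meanReward (hLS : π.LS G₁ G₂) (t : ℕ)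
    (θ : EuclideanSpace ℝ (Fin d)) :
    HasGradientAt (fun θ => M.γ ^ t * M.meanReward π t θ)
      (M.γ ^ t • gradient (M.meanReward π t) θ) θ :=
  hasGradientAt_const_mul _ (M.hasGradientAt_meanReward hLS t θ).differentiableAt.hasGradientAt

lemma hasFDerivAt_discounted_gradient_meanReward (hLS : π.LS G₁ G₂) (t : ℕ)
    (θ : EuclideanSpace ℝ (Fin d)) :
    HasFDerivAt (fun θ => M.γ ^ t • gradient (M.meanReward π t) θ)
      (M.γ ^ t • hessian (M.meanReward π t) θ) θ :=
  (M.hasFDerivAt_gradient_meanReward hLS t θ).differentiableAt.hasFDerivAt.fun_const_smul _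

lemma summable_gradient_bound : Summable fun t : ℕ => M.γ ^ t * (M.Rmax * G₁ * √(t + 1)) := by
  simpa [mul_left_comm] using
    (summable_geometric_mul_sqrt M.γ_pos.le M.γ_lt_one le_rfl).mul_left (M.Rmax * G₁)

lemma summable_hessian_bound :
    Summable fun t : ℕ => M.γ ^ t * (M.Rmax * (G₂ + G₁ ^ 2) * (t + 1)) := by
  simpa [mul_left_comm] using (hasSum_geometric_mul_add M.γ_pos.le M.γ_lt_one 0).summable.mul_left
    (M.Rmax * (G₂ + G₁ ^ 2))

lemma hasGradientAt_truncJ (hLS : π.LS G₁ G₂) (H : ℕ) (θ : EuclideanSpace ℝ (Fin d)) :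
    HasGradientAt (M.truncJ π H) (∑ t ∈ range H, M.γ ^ t • gradient (M.meanReward π t) θ) θ := by
  rw [truncJ_eq_sum]
  exact hasGradientAt_fun_sum fun t _ => M.hasGradientAt_discounted_meanReward hLS t θ

lemma hasGradientAt_J (hLS : π.LS G₁ G₂) (θ : EuclideanSpace ℝ (Fin d)) :
    HasGradientAt (M.J π) (∑' t, M.γ ^ t • gradient (M.meanReward π t) θ) θ := by
  rw [J_eq_tsum]
  exact hasGradientAt_tsum M.summable_gradient_bound
    (M.hasGradientAt_discounted_meanReward hLS)
    (fun t θ => M.norm_pow_smul_le (M.norm_gradient_meanReward_le hLS t θ) t)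
    (M.summable_discounted_meanReward π 0) θ

lemma hasFDerivAt_gradient_truncJ (hLS : π.LS G₁ G₂) (H : ℕ) (θ : EuclideanSpace ℝ (Fin d)) :
    HasFDerivAt (gradient (M.truncJ π H))
      (∑ t ∈ range H, M.γ ^ t • hessian (M.meanReward π t) θ) θ := by
  rw [funext fun θ => (M.hasGradientAt_truncJ hLS H θ).gradient]
  exact HasFDerivAt.fun_sum fun t _ => M.hasFDerivAt_discounted_gradient_meanReward hLS t θ

lemma hasFDerivAt_gradient_J (hLS : π.LS G₁ G₂) (θ : EuclideanSpace ℝ (Fin d)) :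
    HasFDerivAt (gradient (M.J π)) (∑' t, M.γ ^ t • hessian (M.meanReward π t) θ) θ := by
  rw [funext fun θ => (M.hasGradientAt_J hLS θ).gradient]
  exact hasFDerivAt_tsum M.summable_hessian_bound
    (M.hasFDerivAt_discounted_gradient_meanReward hLS)
    (fun t θ => M.norm_pow_smul_le (M.norm_hessian_meanReward_le hLS t θ) t)
    (.of_norm_bounded M.summable_gradient_bound fun t =>
      M.norm_pow_smul_le (M.norm_gradient_meanReward_le hLS t 0) t) θ

theorem norm_gradient_J_sub_gradient_truncJ_le (hLS : π.LS G₁ G₂) (H : ℕ)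
    (θ : EuclideanSpace ℝ (Fin d)) :
    ‖gradient (M.J π) θ - gradient (M.truncJ π H) θ‖ ≤
      G₁ * M.Rmax / (1 - M.γ) * √(1 / (1 - M.γ) + H) * M.γ ^ H := by
  rw [(M.hasGradientAt_J hLS θ).gradient, (M.hasGradientAt_truncJ hLS H θ).gradient]
  calc _ ≤ ∑' n : ℕ, M.γ ^ (n + H) * (M.Rmax * G₁ * √((n + H : ℕ) + 1)) :=
        norm_tsum_sub_sum_range_le M.summable_gradient_bound
          (fun t => M.norm_pow_smul_le (M.norm_gradient_meanReward_le hLS t θ) t) H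
    _ = M.Rmax * G₁ * M.γ ^ H * ∑' n : ℕ, M.γ ^ n * √(n + 1 + H) := by
        rw [← tsum_mul_left]
        congr with n
        rw [Nat.cast_add, add_right_comm, pow_add]
        ring
    _ ≤ M.Rmax * G₁ * M.γ ^ H * (√(H + 1 / (1 - M.γ)) / (1 - M.γ)) := by
        have hR := M.Rmax_pos
        have hG := hLS.G₁_pos
        have hγ := M.γ_pos
        gcongr
        exact tsum_geometric_mul_sqrt_le hγ.le M.γ_lt_one H.cast_nonneg
    _ = _ := by
        rw [add_comm (H : ℝ)]
        ring

theorem norm_hessian_J_sub_hessian_truncJ_le (hLS : π.LS G₁ G₂) (H : ℕ)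
    (θ : EuclideanSpace ℝ (Fin d)) :
    ‖hessian (M.J π) θ - hessian (M.truncJ π H) θ‖ ≤
      M.Rmax * (G₂ + G₁ ^ 2) / (1 - M.γ) * (H + 1 / (1 - M.γ)) * M.γ ^ H := by
  rw [hessian, hessian, (M.hasFDerivAt_gradient_J hLS θ).fderiv,
    (M.hasFDerivAt_gradient_truncJ hLS H θ).fderiv]
  calc _ ≤ ∑' n : ℕ, M.γ ^ (n + H) * (M.Rmax * (G₂ + G₁ ^ 2) * ((n + H : ℕ) + 1)) :=
        norm_tsum_sub_sum_range_le M.summable_hessian_bound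
          (fun t => M.norm_pow_smul_le (M.norm_hessian_meanReward_le hLS t θ) t) H
    _ = M.Rmax * (G₂ + G₁ ^ 2) * M.γ ^ H * ∑' n : ℕ, M.γ ^ n * (n + 1 + H) := by
        rw [← tsum_mul_left]
        congr with n
        rw [Nat.cast_add, add_right_comm, pow_add]
        ring
    _ = _ := by
        rw [(hasSum_geometric_mul_add M.γ_pos.le M.γ_lt_one H).tsum_eq]
        ring

end Objective

section RewardToGo

lemma sum_rewardToGo_smul {V : Type*} [AddCommGroup V] [Module ℝ V] (H : ℕ) (τ : ℕ → S × A)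
    (x : ℕ → V) :
    ∑ h ∈ range H, M.rewardToGo H h τ • x h =
      ∑ t ∈ range H, (M.γ ^ t * M.R (τ t).1 (τ t).2) • ∑ h ∈ range (t + 1), x h := by
  simp_rw [rewardToGo, sum_smul, smul_sum]
  exact sum_comm' fun h t => by grind

lemma truncPhi_eq_sum_truncLogLik (π : PolicyFamily S ν d) (H : ℕ) (τ : ℕ → S × A) :
    M.truncPhi π H τ = fun θ =>
      ∑ t ∈ range H, M.γ ^ t * M.R (τ t).1 (τ t).2 * truncLogLik π (t + 1) τ θ := by
  ext θ
  simp_rw [truncPhi, ← sum_mul]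
  exact M.sum_rewardToGo_smul H τ fun h => π.logDens (τ h).1 (τ h).2 θ

lemma gradient_truncPhi (hLS : π.LS G₁ G₂) (H : ℕ) (τ : ℕ → S × A) :
    gradient (M.truncPhi π H τ) = fun θ =>
      ∑ t ∈ range H, (M.γ ^ t * M.R (τ t).1 (τ t).2) • truncScore π (t + 1) τ θ := by
  ext1 θ
  rw [truncPhi_eq_sum_truncLogLik]
  exact (hasGradientAt_fun_sum fun t _ =>
    hasGradientAt_const_mul _ (hasGradientAt_truncLogLik hLS (t + 1) τ θ)).gradient

lemma gradient_truncPhi_eq_sum_rewardToGo (hLS : π.LS G₁ G₂) (H : ℕ) (τ : ℕ → S × A)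
    (θ : EuclideanSpace ℝ (Fin d)) :
    gradient (M.truncPhi π H τ) θ =
      ∑ h ∈ range H, M.rewardToGo H h τ • gradient (π.logDens (τ h).1 (τ h).2) θ := by
  rw [gradient_truncPhi M hLS, sum_rewardToGo_smul]
  rfl

lemma hasFDerivAt_gradient_truncPhi (hLS : π.LS G₁ G₂) (H : ℕ) (τ : ℕ → S × A)
    (θ : EuclideanSpace ℝ (Fin d)) :
    HasFDerivAt (gradient (M.truncPhi π H τ))
      (∑ t ∈ range H, (M.γ ^ t * M.R (τ t).1 (τ t).2) • hessian (truncLogLik π (t + 1) τ) θ)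
      θ := by
  rw [gradient_truncPhi M hLS]
  exact HasFDerivAt.fun_sum fun t _ => (hasFDerivAt_truncScore hLS (t + 1) τ θ).fun_const_smul _

lemma stronglyMeasurable_gradient_truncPhi (hLS : π.LS G₁ G₂) (H : ℕ)
    (θ : EuclideanSpace ℝ (Fin d)) :
    StronglyMeasurable[strictPast (fun _ => S × A) H]
      fun τ => gradient (M.truncPhi π H τ) θ := by
  simp_rw [gradient_truncPhi M hLS]
  exact stronglyMeasurable_fun_sum _ fun t ht =>
    (((M.stronglyMeasurable_reward t).const_mul _).smul
      (stronglyMeasurable_truncScore hLS (t + 1) θ)).mono (strictPast_mono (mem_range.1 ht))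

lemma norm_sum_discounted_reward_smul_le {V : Type*} [NormedAddCommGroup V] [NormedSpace ℝ V]
    {x : ℕ → V} {c : ℝ} (hx : ∀ t, ‖x (t + 1)‖ ≤ (t + 1 : ℕ) * c) (H : ℕ) (τ : ℕ → S × A) :
    ‖∑ t ∈ range H, (M.γ ^ t * M.R (τ t).1 (τ t).2) • x (t + 1)‖ ≤
      ∑ t ∈ range H, M.γ ^ t * M.Rmax * ((t + 1 : ℕ) * c) :=
  norm_sum_le_of_le _ fun t _ =>
    norm_smul_le_of_le (M.norm_pow_smul_le (M.abs_R_le _ _) t) (hx t)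

lemma norm_gradient_truncPhi_le (hLS : π.LS G₁ G₂) (H : ℕ) (τ : ℕ → S × A)
    (θ : EuclideanSpace ℝ (Fin d)) :
    ‖gradient (M.truncPhi π H τ) θ‖ ≤ ∑ t ∈ range H, M.γ ^ t * M.Rmax * ((t + 1 : ℕ) * G₁) := by
  rw [gradient_truncPhi M hLS]
  exact M.norm_sum_discounted_reward_smul_le (x := fun n => truncScore π n τ θ)
    (fun t => norm_truncScore_le hLS (t + 1) τ θ) H τ

lemma norm_hessian_truncPhi_le (hLS : π.LS G₁ G₂) (H : ℕ) (τ : ℕ → S × A)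
    (θ : EuclideanSpace ℝ (Fin d)) :
    ‖hessian (M.truncPhi π H τ) θ‖ ≤ ∑ t ∈ range H, M.γ ^ t * M.Rmax * ((t + 1 : ℕ) * G₂) := by
  rw [hessian, (M.hasFDerivAt_gradient_truncPhi hLS H τ θ).fderiv]
  exact M.norm_sum_discounted_reward_smul_le (x := fun n => hessian (truncLogLik π n τ) θ)
    (fun t => norm_hessian_truncLogLik_le hLS (t + 1) τ θ) H τ

end RewardToGo

section PolicyDerivatives

variable [SigmaFinite ν]

lemma gradient_truncJ_eq_integral_gradient_truncPhi (hLS : π.LS G₁ G₂) (H : ℕ)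
    (θ : EuclideanSpace ℝ (Fin d)) :
    gradient (M.truncJ π H) θ = ∫ τ, gradient (M.truncPhi π H τ) θ ∂(M.trajLaw π θ) := by
  have hint (t) : Integrable (fun τ => (M.γ ^ t * M.R (τ t).1 (τ t).2) • truncScore π (t + 1) τ θ)
      (M.trajLaw π θ) :=
    integrable_of_stronglyMeasurable_strictPast
      (((M.stronglyMeasurable_reward t).const_mul _).smul
        (stronglyMeasurable_truncScore hLS (t + 1) θ))
      fun τ => norm_smul_le_of_le (M.norm_pow_smul_le (M.abs_R_le _ _) t)
        (norm_truncScore_le hLS (t + 1) τ θ)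
  simp_rw [(M.hasGradientAt_truncJ hLS H θ).gradient, gradient_truncPhi M hLS,
    integral_finsetSum _ fun t _ => hint t, (M.hasGradientAt_meanReward hLS _ θ).gradient,
    mul_smul, integral_smul]

theorem gradient_truncJ_eq_truncPolicyGradient (hLS : π.LS G₁ G₂) (H : ℕ)
    (θ : EuclideanSpace ℝ (Fin d)) :
    gradient (M.truncJ π H) θ = M.truncPolicyGradient π H θ := by
  simp_rw [gradient_truncJ_eq_integral_gradient_truncPhi M hLS,
    gradient_truncPhi_eq_sum_rewardToGo M hLS, truncPolicyGradient]

theorem hessian_truncJ_eq_truncPolicyHessian (hLS : π.LS G₁ G₂) (H : ℕ)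
    (θ : EuclideanSpace ℝ (Fin d)) :
    hessian (M.truncJ π H) θ = M.truncPolicyHessian π H θ := by
  have hhess (θ τ) : HasFDerivAt (gradient (M.truncPhi π H τ)) (hessian (M.truncPhi π H τ) θ) θ :=
    (M.hasFDerivAt_gradient_truncPhi hLS H τ θ).differentiableAt.hasFDerivAt
  rw [hessian, funext (M.gradient_truncJ_eq_integral_gradient_truncPhi hLS H),
    (M.hasFDerivAt_integral_trajLaw hLS (M.stronglyMeasurable_gradient_truncPhi hLS H) hhess
      (fun θ τ => M.norm_gradient_truncPhi_le hLS H τ θ)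
      (fun θ τ => M.norm_hessian_truncPhi_le hLS H τ θ) θ).fderiv]
  simp_rw [truncPolicyHessian, InnerProductSpace.rankOne_def, hessian, add_comm]

end PolicyDerivatives

end MDP

theorem lemma2 {S A : Type*} [MeasurableSpace S] [MeasurableSpace A]
    (M : MDP S A) (ν : Measure A) [SigmaFinite ν] (d : ℕ) (π : PolicyFamily S ν d)
    (G₁ G₂ : ℝ) (hLS : π.LS G₁ G₂) (H : ℕ) :
    -- the gradients and the Hessians exist everywhere
    (Differentiable ℝ (M.J π) ∧ Differentiable ℝ (gradient (M.J π))) ∧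
    (Differentiable ℝ (M.truncJ π H) ∧ Differentiable ℝ (gradient (M.truncJ π H))) ∧
    -- those of the truncated objective are the truncated policy gradient and policy Hessian
    (∀ θ, gradient (M.truncJ π H) θ = M.truncPolicyGradient π H θ ∧
      hessian (M.truncJ π H) θ = M.truncPolicyHessian π H θ) ∧
    -- the truncation errors
    (∀ θ, ‖gradient (M.J π) θ - gradient (M.truncJ π H) θ‖ ≤
        G₁ * M.Rmax / (1 - M.γ) * √(1 / (1 - M.γ) + (H : ℝ)) * M.γ ^ H ∧
      ‖hessian (M.J π) θ - hessian (M.truncJ π H) θ‖ ≤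
        M.Rmax * (G₂ + G₁ ^ 2) / (1 - M.γ) * ((H : ℝ) + 1 / (1 - M.γ)) * M.γ ^ H) :=
  ⟨⟨fun θ => (M.hasGradientAt_J hLS θ).differentiableAt,
      fun θ => (M.hasFDerivAt_gradient_J hLS θ).differentiableAt⟩,
    ⟨fun θ => (M.hasGradientAt_truncJ hLS H θ).differentiableAt,
      fun θ => (M.hasFDerivAt_gradient_truncJ hLS H θ).differentiableAt⟩,
    fun θ => ⟨M.gradient_truncJ_eq_truncPolicyGradient hLS H θ,
      M.hessian_truncJ_eq_truncPolicyHessian hLS H θ⟩,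
    fun θ => ⟨M.norm_gradient_J_sub_gradient_truncJ_le hLS H θ,
      M.norm_hessian_J_sub_hessian_truncJ_le hLS H θ⟩⟩
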